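/- Let $N\ge 3$, let $\Omega\subset\mathbb{R}^N$ be an open set with compact complement, let $r_0>0$ be such that $|x|\ge r_0$ for all $x\in\Omega$, let $\alpha>0$ and $2+\frac4N<p<\frac{2N}{N-2}$. For $\rho\in[\frac12,1]$ and $u\in H_0^1(\Omega)$ (real-valued) put $$E_\rho(u)=\frac12\int_\Omega|\nabla u|^2\,dx-\frac{\rho}{p}\int_\Omega|x|^{-\alpha}|u|^p\,dx ,$$ where the last integral is finite, and for $\mu>0$ let $S_\mu=\{u\in H_0^1(\Omega):\int_\Omega u^2\,dx=\mu\}$. Let $\gamma_p=\frac{N(p-2)}{2p}$, let $C_{p,N}$ be the optimal constant in the Gagliardo--Nirenberg inequality $$\int_{\mathbb{R}^N}|w|^p\le C_{p,N}\Big(\int_{\mathbb{R}^N}w^2\Big)^{\frac{p(1-\gamma_p)}{2}}\Big(\int_{\mathbb{R}^N}|\nabla w|^2\Big)^{\frac{p\gamma_p}{2}},\qquad w\in H^1(\mathbb{R}^N),$$ and put $$k_0=\Big(\frac{r_0^{\alpha}\,p}{4C_{p,N}}\Big)^{\frac{2}{p\gamma_p-2}}\mu^{-\frac{(1-\gamma_p)p}{p\gamma_p-2}}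 .$$ Then for every $\mu>0$ we have $k_0>0$, and there exist $w_1,w_2\in S_\mu$, independent of $\rho\in[\frac12,1]$, such that the set $\Gamma=\{\gamma\in C([0,1],S_\mu):\gamma(0)=w_1,\ \gamma(1)=w_2\}$ is non-empty, $t\mapsto E_\rho(\gamma(t))$ attains its maximum on $[0,1]$ for all $\gamma\in\Gamma$ and $\rho\in[\frac12,1]$, and the mountain pass level $$c_\rho(\mu):=\inf_{\gamma\in\Gamma}\max_{t\in[0,1]}E_\rho(\gamma(t))$$ satisfies $$c_\rho(\mu)>\max\{E_\rho(w_1),E_\rho(w_2)\}\qquad\text{for all }\rho\in[\tfrac12,1],$$ uniformly in $\rho$: there is $\delta>0$ with $c_\rho(\mu)\ge\max\{E_\rho(w_1),E_\rho(w_2)\}+\delta$ for all $\rho\in[\frac12,1]$. Moreover $$c_\rho(\mu)\ge\frac{k_0}{4}\qquad\text{for all }\rho\in[\tfrac12,1].$$ -/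

import Mathlib

open MeasureTheory Set Topology
open scoped ContDiff Gradient

noncomputable section

namespace ExteriorNLS

/-- `ℝ^N` with the Euclidean norm. -/
abbrev Space (N : ℕ) : Type := EuclideanSpace ℝ (Fin N)

/-- `φ ∈ C_c^∞(Ω)`: smooth on `ℝ^N`, with compact support contained in `Ω`. -/
structure IsTestFunction {N : ℕ} (Ω : Set (Space N)) (φ : Space N → ℝ) : Prop where
  smooth : ContDiff ℝ ∞ φ
  compact : HasCompactSupport φ
  support_subset : tsupport φ ⊆ Ω

/-- The Hilbert space `L²(Ω) × L²(Ω; ℝ^N)`, with squared norm `‖u‖₂² + ‖g‖₂²`. -/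
abbrev L2Pair {N : ℕ} (Ω : Set (Space N)) : Type :=
  WithLp 2 (Lp ℝ 2 (volume.restrict Ω) × Lp (Space N) 2 (volume.restrict Ω))

lemma IsTestFunction.add {N : ℕ} {Ω : Set (Space N)} {φ ψ : Space N → ℝ}
    (hφ : IsTestFunction Ω φ) (hψ : IsTestFunction Ω ψ) :
    IsTestFunction Ω (fun x => φ x + ψ x) :=
  ⟨hφ.smooth.add hψ.smooth, hφ.compact.add hψ.compact,
    (tsupport_add φ ψ).trans (union_subset hφ.support_subset hψ.support_subset)⟩

lemma IsTestFunction.const_mul {N : ℕ} {Ω : Set (Space N)} {φ : Space N → ℝ}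
    (c : ℝ) (hφ : IsTestFunction Ω φ) : IsTestFunction Ω (fun x => c * φ x) :=
  ⟨contDiff_const.mul hφ.smooth, hφ.compact.mul_left,
    (tsupport_mul_subset_right (f := fun _ => c) (g := φ)).trans hφ.support_subset⟩

lemma IsTestFunction.differentiable {N : ℕ} {Ω : Set (Space N)} {φ : Space N → ℝ}
    (hφ : IsTestFunction Ω φ) : Differentiable ℝ φ :=
  hφ.smooth.differentiable (by simp)

/-- The pairs `(φ, ∇φ)` with `φ ∈ C_c^∞(Ω)`. -/
def testGraph {N : ℕ} (Ω : Set (Space N)) : Submodule ℝ (L2Pair Ω) where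
  carrier := {U | ∃ φ : Space N → ℝ, IsTestFunction Ω φ ∧
    U.fst =ᵐ[volume.restrict Ω] φ ∧ U.snd =ᵐ[volume.restrict Ω] ∇ φ}
  zero_mem' := by
    refine ⟨fun _ => 0, ⟨contDiff_const, HasCompactSupport.zero, ?_⟩, ?_, ?_⟩
    · have h : tsupport (fun _ : Space N => (0 : ℝ)) = ∅ := tsupport_eq_empty_iff.2 rfl
      rw [h]
      exact empty_subset _
    · exact Lp.coeFn_zero _ _ _
    · have h : ∇ (fun _ : Space N => (0 : ℝ)) = 0 := by
        ext1 x
        simp [gradient]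
      rw [h]
      exact Lp.coeFn_zero _ _ _
  add_mem' := by
    rintro U V ⟨φ, hφ, hU, hU'⟩ ⟨ψ, hψ, hV, hV'⟩
    refine ⟨fun x => φ x + ψ x, hφ.add hψ, ?_, ?_⟩
    · filter_upwards [Lp.coeFn_add U.fst V.fst, hU, hV] with x h h1 h2
      simpa [h1, h2] using h
    · filter_upwards [Lp.coeFn_add U.snd V.snd, hU', hV'] with x h h1 h2
      have e : ∇ (fun x => φ x + ψ x) x = ∇ φ x + ∇ ψ x := by
        simp only [gradient]
        rw [fderiv_fun_add (hφ.differentiable x) (hψ.differentiable x), map_add]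
      rw [e, ← h1, ← h2]
      exact h
  smul_mem' := by
    rintro c U ⟨φ, hφ, hU, hU'⟩
    refine ⟨fun x => c * φ x, hφ.const_mul c, ?_, ?_⟩
    · filter_upwards [Lp.coeFn_smul c U.fst, hU] with x h h1
      simpa [h1] using h
    · filter_upwards [Lp.coeFn_smul c U.snd, hU'] with x h h1
      have e : ∇ (fun x => c * φ x) x = c • ∇ φ x := by
        simp only [gradient]
        rw [fderiv_const_mul (hφ.differentiable x), map_smul]
      rw [e, ← h1]
      exact h

/-- `H₀¹(Ω)`, the closure of `C_c^∞(Ω)` in the `H¹` norm. An element is realised as the pair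
`(u, ∇u)` consisting of a function `u ∈ L²(Ω)` and its weak gradient `∇u ∈ L²(Ω; ℝ^N)`;
`integral_fn_mul_fderiv` and `ext_of_fn_eq` below show that the second component is indeed the weak gradient
of the first and is determined by it. The norm is `(‖u‖₂² + ‖∇u‖₂²)^{1/2}`.
`H01 univ` is `H₀¹(ℝ^N) = H¹(ℝ^N)`. -/
def H01 {N : ℕ} (Ω : Set (Space N)) : Submodule ℝ (L2Pair Ω) :=
  (testGraph Ω).topologicalClosure

/-- The function underlying an element of `H₀¹(Ω)`. -/
def fn {N : ℕ} {Ω : Set (Space N)} (u : H01 Ω) : Lp ℝ 2 (volume.restrict Ω) := u.1.fst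

/-- The weak gradient of an element of `H₀¹(Ω)`. -/
def grad {N : ℕ} {Ω : Set (Space N)} (u : H01 Ω) : Lp (Space N) 2 (volume.restrict Ω) :=
  u.1.snd

lemma IsTestFunction.continuous_fderiv_apply {N : ℕ} {Ω : Set (Space N)} {φ : Space N → ℝ}
    (hφ : IsTestFunction Ω φ) (v : Space N) : Continuous (fun x => fderiv ℝ φ x v) :=
  (hφ.smooth.continuous_fderiv (by simp)).clm_apply continuous_const

lemma IsTestFunction.compact_fderiv_apply {N : ℕ} {Ω : Set (Space N)} {φ : Space N → ℝ}
    (hφ : IsTestFunction Ω φ) (v : Space N) : HasCompactSupport (fun x => fderiv ℝ φ x v) :=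
  hφ.compact.fderiv_apply ℝ v

/-- `∇u` is the weak gradient of `u`:
`∫_Ω u ∂_v φ = - ∫_Ω ⟨∇u, v⟩ φ` for every `φ ∈ C_c^∞(Ω)` and every direction `v`. -/
theorem integral_fn_mul_fderiv {N : ℕ} {Ω : Set (Space N)} (u : H01 Ω) {φ : Space N → ℝ}
    (hφ : IsTestFunction Ω φ) (v : Space N) :
    ∫ x in Ω, (fn u) x * fderiv ℝ φ x v = - ∫ x in Ω, inner ℝ ((grad u) x) v * φ x := by
  have hd := hφ.continuous_fderiv_apply v
  have m1 : MemLp (fun x => fderiv ℝ φ x v) 2 (volume.restrict Ω) :=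
    hd.memLp_of_hasCompactSupport (hφ.compact_fderiv_apply v)
  have hφv : Continuous (fun x => φ x • v) := hφ.smooth.continuous.smul continuous_const
  have m2 : MemLp (fun x => φ x • v) 2 (volume.restrict Ω) :=
    hφv.memLp_of_hasCompactSupport hφ.compact.smul_right
  have key : ∀ U : L2Pair Ω,
      (∫ x in Ω, U.fst x * fderiv ℝ φ x v) + ∫ x in Ω, inner ℝ (U.snd x) v * φ x
        = inner ℝ m1.toLp U.fst + inner ℝ m2.toLp U.snd := by
    intro U
    rw [L2.inner_def, L2.inner_def]
    congr 1
    · refine integral_congr_ae ?_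
      filter_upwards [m1.coeFn_toLp] with x hx
      simp [hx]
    · refine integral_congr_ae ?_
      filter_upwards [m2.coeFn_toLp] with x hx
      simp [hx, inner_smul_left, real_inner_comm, mul_comm]
  have hclosed : IsClosed {U : L2Pair Ω |
      (inner ℝ m1.toLp U.fst + inner ℝ m2.toLp U.snd : ℝ) = 0} := by
    refine isClosed_eq ?_ continuous_const
    have c1 : Continuous (fun U : L2Pair Ω => U.fst) :=
      continuous_fst.comp (WithLp.prod_continuous_ofLp 2 _ _)
    have c2 : Continuous (fun U : L2Pair Ω => U.snd) :=
      continuous_snd.comp (WithLp.prod_continuous_ofLp 2 _ _)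
    exact (continuous_const.inner c1).add (continuous_const.inner c2)
  have hsub : (testGraph Ω : Set (L2Pair Ω)) ⊆ {U : L2Pair Ω |
      (inner ℝ m1.toLp U.fst + inner ℝ m2.toLp U.snd : ℝ) = 0} := by
    rintro U ⟨ψ, hψ, h1, h2⟩
    rw [mem_ofPred_eq, ← key]
    have e1 : ∫ x in Ω, U.fst x * fderiv ℝ φ x v = ∫ x, ψ x * fderiv ℝ φ x v := by
      rw [← setIntegral_eq_integral_of_forall_compl_eq_zero (s := Ω)
        (f := fun x => ψ x * fderiv ℝ φ x v)]
      · refine integral_congr_ae ?_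
        filter_upwards [h1] with x hx
        rw [hx]
      · intro x hx
        rw [image_eq_zero_of_notMem_tsupport fun h => hx (hψ.support_subset h), zero_mul]
    have e2 : ∫ x in Ω, inner ℝ (U.snd x) v * φ x = ∫ x, fderiv ℝ ψ x v * φ x := by
      rw [← setIntegral_eq_integral_of_forall_compl_eq_zero (s := Ω)
        (f := fun x => fderiv ℝ ψ x v * φ x)]
      · refine integral_congr_ae ?_
        filter_upwards [h2] with x hx
        rw [hx]
        simp [gradient]
      · intro x hx
        rw [image_eq_zero_of_notMem_tsupport fun h => hx (hφ.support_subset h), mul_zero]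
    rw [e1, e2, integral_mul_fderiv_eq_neg_fderiv_mul_of_integrable, neg_add_cancel]
    · exact ((hψ.continuous_fderiv_apply v).mul hφ.smooth.continuous).integrable_of_hasCompactSupport
        hφ.compact.mul_left
    · exact (hψ.smooth.continuous.mul hd).integrable_of_hasCompactSupport hψ.compact.mul_right
    · exact (hψ.smooth.continuous.mul hφ.smooth.continuous).integrable_of_hasCompactSupport
        hψ.compact.mul_right
    · exact fun x _ => hψ.differentiable x
    · exact fun x _ => hφ.differentiable x
  have hu : u.1 ∈ closure (testGraph Ω : Set (L2Pair Ω)) := u.2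
  have h0 := closure_minimal hsub hclosed hu
  rw [mem_ofPred_eq, ← key] at h0
  exact eq_neg_of_add_eq_zero_left h0

/-- An element of `H₀¹(Ω)` is determined by its underlying function. -/
theorem ext_of_fn_eq {N : ℕ} {Ω : Set (Space N)} (hΩ : IsOpen Ω) {u w : H01 Ω} (h : (fn u) = (fn w)) :
    u = w := by
  have hg : (grad u) = (grad w) := by
    refine Lp.ext ?_
    have hall : ∀ v : Space N, ∀ᵐ x ∂volume, x ∈ Ω →
        inner ℝ ((grad u) x - (grad w) x) v = (0 : ℝ) := by
      intro v
      have hmem : MemLp (fun x => inner ℝ ((grad u) x - (grad w) x) v) 2 (volume.restrict Ω) :=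
        ((Lp.memLp (grad u)).sub (Lp.memLp (grad w))).inner_const v
      refine hΩ.ae_eq_zero_of_integral_contDiff_smul_eq_zero ?_ ?_
      · exact (locallyIntegrableOn_of_locallyIntegrable_restrict
          (hmem.locallyIntegrable (by norm_num)))
      · intro φ h1 h2 h3
        have hφ : IsTestFunction Ω φ := ⟨h1, h2, h3⟩
        have hi : ∀ y : H01 Ω, IntegrableOn (fun x => inner ℝ ((grad y) x) v * φ x) Ω := fun y =>
          MemLp.integrable_mul (p := 2) (q := 2) ((Lp.memLp (grad y)).inner_const v)
            (h1.continuous.memLp_of_hasCompactSupport h2)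
        rw [← setIntegral_eq_integral_of_forall_compl_eq_zero (s := Ω)]
        · have e : ∀ x, φ x • (inner ℝ ((grad u) x - (grad w) x) v : ℝ)
              = inner ℝ ((grad u) x) v * φ x - inner ℝ ((grad w) x) v * φ x := by
            intro x
            rw [inner_sub_left, smul_eq_mul]
            ring
          simp_rw [e]
          rw [integral_sub (hi u) (hi w)]
          have a := integral_fn_mul_fderiv u hφ v
          have b := integral_fn_mul_fderiv w hφ v
          rw [h] at a
          linarith
        · intro x hx
          rw [image_eq_zero_of_notMem_tsupport fun h' => hx (h3 h'), zero_smul]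
    have hall' : ∀ᵐ x ∂(volume.restrict Ω), ∀ i : Fin N,
        inner ℝ ((grad u) x - (grad w) x) (EuclideanSpace.single i (1 : ℝ)) = (0 : ℝ) :=
      ae_all_iff.2 fun i => (ae_restrict_iff' hΩ.measurableSet).2 (hall _)
    filter_upwards [hall'] with x hx
    rw [← sub_eq_zero]
    ext i
    simpa [EuclideanSpace.inner_single_right] using hx i
  have h' : u.1 = w.1 := by
    apply (WithLp.equiv 2 _).injective
    exact Prod.ext h hg
  exact Subtype.ext h'

/-- `∫_Ω u²`. -/
def mass {N : ℕ} {Ω : Set (Space N)} (u : H01 Ω) : ℝ := ∫ x in Ω, (fn u x) ^ 2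

/-- `∫_Ω |∇u|²`. -/
def dirichlet {N : ℕ} {Ω : Set (Space N)} (u : H01 Ω) : ℝ := ∫ x in Ω, ‖(grad u) x‖ ^ 2

/-- `E_ρ(u) = ½ ∫_Ω |∇u|² - (ρ/p) ∫_Ω |x|^{-α} |u|^p`. -/
def energy {N : ℕ} {Ω : Set (Space N)} (α p ρ : ℝ) (u : H01 Ω) : ℝ :=
  1 / 2 * dirichlet u - ρ / p * ∫ x in Ω, ‖x‖ ^ (-α) * |(fn u) x| ^ p

/-- `S_μ = {u ∈ H₀¹(Ω) : ∫_Ω u² = μ}`; as a type, it carries the topology of `H₀¹(Ω)`. -/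
def massSphere {N : ℕ} (Ω : Set (Space N)) (μ : ℝ) : Set (H01 Ω) := {u | mass u = μ}

/-- The mountain pass level `c_ρ(μ) = inf_{γ ∈ Γ} max_{t ∈ [0,1]} E_ρ(γ(t))`, where `Γ` is the set
of continuous paths `γ : [0,1] → S_μ` with `γ(0) = w₁` and `γ(1) = w₂`. -/
def mountainPassLevel {N : ℕ} {Ω : Set (Space N)} {μ : ℝ} (α p ρ : ℝ)
    (w₁ w₂ : massSphere Ω μ) : ℝ :=
  ⨅ γ : Path w₁ w₂, ⨆ t : unitInterval, energy α p ρ (γ t).1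

/-- `γ_p = N(p-2)/(2p)`. -/
def gammaExp (N : ℕ) (p : ℝ) : ℝ := N * (p - 2) / (2 * p)

/-- The optimal constant `C_{p,N}` in the Gagliardo-Nirenberg inequality
`∫ |w|^p ≤ C (∫ w²)^{p(1-γ_p)/2} (∫ |∇w|²)^{pγ_p/2}` for `w ∈ H¹(ℝ^N)`. -/
def gnConst (N : ℕ) (p : ℝ) : ℝ :=
  sInf {C : ℝ | 0 ≤ C ∧ ∀ w : H01 (univ : Set (Space N)),
    ∫ x in univ, |(fn w) x| ^ p ≤
      C * mass w ^ (p * (1 - gammaExp N p) / 2) * dirichlet w ^ (p * gammaExp N p / 2)}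

/-- `k₀ = (r₀^α p / (4 C_{p,N}))^{2/(pγ_p-2)} μ^{-(1-γ_p)p/(pγ_p-2)}`. -/
def kZero (N : ℕ) (α p r₀ μ : ℝ) : ℝ :=
  (r₀ ^ α * p / (4 * gnConst N p)) ^ (2 / (p * gammaExp N p - 2)) *
    μ ^ (-((1 - gammaExp N p) * p / (p * gammaExp N p - 2)))

end ExteriorNLS

end

open ExteriorNLS

/-! The Dirichlet integral separates the two endpoints. On Ω the weight is at most `r₀ ^ (-α)`, so
Gagliardo–Nirenberg bounds the potential term on `S_μ` by a constant times the power pγ_p/2 of the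
Dirichlet integral. Since pγ_p > 2, this is superlinear, and k₀ is the value at which the bound
equals pk₀/4. Hence E_ρ ≥ k₀/2 - ρk₀/4 ≥ k₀/4 wherever the Dirichlet integral is k₀
(`kZero_div_four_le_energy`).

Rescaled bumps of mass μ supply the endpoints (`exists_endpoints`). A spread-out one has Dirichlet
integral at most k₀/4, hence energy at most k₀/8. A concentrated one has Dirichlet integral above k₀
and energy at most 0 for every ρ ≥ 1/2, again because pγ_p > 2. By the intermediate value theorem
every path crosses the level k₀, so the mountain pass level is at least k₀/4, with gap δ = k₀/8 for
all ρ. Paths exist because both endpoints are nonnegative: the segment joining them avoids 0 and can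
be projected onto `S_μ`.

The inequality comes from Sobolev and interpolation on test functions, then density. Applied to
differences, it also makes the energy continuous, so maxima along paths are attained. -/

noncomputable section

namespace ExteriorNLS

open Filter
open scoped ENNReal NNReal

/-! ### Interpolation of Lebesgue norms -/

/-- Log-convexity of `L^p` norms. -/
lemma eLpNorm_le_eLpNorm_rpow_mul_eLpNorm_rpow {X E : Type*} [MeasurableSpace X]
    [NormedAddCommGroup E] {ν : Measure X} {f : X → E} (hf : AEStronglyMeasurable f ν)
    {r q p θ : ℝ} (hr : 0 < r) (hq : 0 < q) (hp : 0 < p) (hθ0 : 0 ≤ θ) (hθ1 : θ ≤ 1)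
    (h : 1 / p = (1 - θ) / r + θ / q) :
    eLpNorm f (ENNReal.ofReal p) ν ≤
      eLpNorm f (ENNReal.ofReal r) ν ^ (1 - θ) * eLpNorm f (ENNReal.ofReal q) ν ^ θ := by
  have e : ∀ s : ℝ, 0 < s → eLpNorm f (ENNReal.ofReal s) ν
      = (∫⁻ x, ‖f x‖ₑ ^ s ∂ν) ^ (1 / s) := by
    intro s hs
    rw [eLpNorm_eq_lintegral_rpow_enorm_toReal (by simpa using hs) ENNReal.ofReal_ne_top,
      ENNReal.toReal_ofReal hs.le]
  rw [e p hp, e r hr, e q hq, ← ENNReal.rpow_mul, ← ENNReal.rpow_mul]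
  have ha : 0 ≤ p * ((1 - θ) / r) := mul_nonneg hp.le (div_nonneg (by linarith) hr.le)
  have hb : 0 ≤ p * (θ / q) := mul_nonneg hp.le (div_nonneg hθ0 hq.le)
  have hab : p * ((1 - θ) / r) + p * (θ / q) = 1 := by
    rw [← mul_add, ← h]
    field_simp
  have hm : ∀ s : ℝ, AEMeasurable (fun x => ‖f x‖ₑ ^ s) ν := fun s => hf.enorm.pow_const s
  -- Hölder for |f|^r and |f|^q with the weights p(1-θ)/r and pθ/q, which sum to 1 by `h`.
  have key := ENNReal.lintegral_mul_norm_pow_le (hm r) (hm q) ha hb hab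
  have e1 : ∀ x, (‖f x‖ₑ ^ r) ^ (p * ((1 - θ) / r)) * (‖f x‖ₑ ^ q) ^ (p * (θ / q))
      = ‖f x‖ₑ ^ p := by
    intro x
    rw [← ENNReal.rpow_mul, ← ENNReal.rpow_mul, ← ENNReal.rpow_add_of_nonneg]
    · congr 1
      field_simp
      ring
    · exact mul_nonneg hr.le ha
    · exact mul_nonneg hq.le hb
  simp_rw [e1] at key
  refine (ENNReal.rpow_le_rpow key (by positivity : 0 ≤ 1 / p)).trans_eq ?_
  rw [ENNReal.mul_rpow_of_nonneg _ _ (by positivity), ← ENNReal.rpow_mul, ← ENNReal.rpow_mul]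
  congr 2 <;> field_simp

variable {N : ℕ} {Ω : Set (Space N)}

/-! ### Test functions in H₀¹ and density -/

lemma IsTestFunction.continuous_gradient {φ : Space N → ℝ} (hφ : IsTestFunction Ω φ) :
    Continuous (∇ φ) :=
  (InnerProductSpace.toDual ℝ (Space N)).symm.continuous.comp
    (hφ.smooth.continuous_fderiv (by simp))

lemma IsTestFunction.compact_gradient {φ : Space N → ℝ} (hφ : IsTestFunction Ω φ) :
    HasCompactSupport (∇ φ) :=
  (hφ.compact.fderiv ℝ).comp_left (g := (InnerProductSpace.toDual ℝ (Space N)).symm) (map_zero _)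

lemma norm_gradient (φ : Space N → ℝ) (x : Space N) : ‖∇ φ x‖ = ‖fderiv ℝ φ x‖ :=
  LinearIsometryEquiv.norm_map _ _

lemma IsTestFunction.memLp {φ : Space N → ℝ} (hφ : IsTestFunction Ω φ) (p : ℝ≥0∞)
    (s : Set (Space N)) : MemLp φ p (volume.restrict s) :=
  hφ.smooth.continuous.memLp_of_hasCompactSupport hφ.compact

lemma IsTestFunction.memLp_gradient {φ : Space N → ℝ} (hφ : IsTestFunction Ω φ) (p : ℝ≥0∞)
    (s : Set (Space N)) : MemLp (∇ φ) p (volume.restrict s) :=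
  hφ.continuous_gradient.memLp_of_hasCompactSupport hφ.compact_gradient

/-- A test function as an element of `H₀¹(Ω)`. -/
def IsTestFunction.toH01 {φ : Space N → ℝ} (hφ : IsTestFunction Ω φ) : H01 Ω :=
  ⟨WithLp.toLp 2 ((hφ.memLp 2 Ω).toLp φ, (hφ.memLp_gradient 2 Ω).toLp (∇ φ)),
    Submodule.le_topologicalClosure _ ⟨φ, hφ, (hφ.memLp 2 Ω).coeFn_toLp,
      (hφ.memLp_gradient 2 Ω).coeFn_toLp⟩⟩

lemma IsTestFunction.fn_toH01 {φ : Space N → ℝ} (hφ : IsTestFunction Ω φ) :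
    fn hφ.toH01 =ᵐ[volume.restrict Ω] φ := (hφ.memLp 2 Ω).coeFn_toLp

lemma IsTestFunction.grad_toH01 {φ : Space N → ℝ} (hφ : IsTestFunction Ω φ) :
    grad hφ.toH01 =ᵐ[volume.restrict Ω] ∇ φ := (hφ.memLp_gradient 2 Ω).coeFn_toLp

lemma IsTestFunction.mono {s : Set (Space N)} {φ : Space N → ℝ} (hφ : IsTestFunction Ω φ)
    (h : Ω ⊆ s) : IsTestFunction s φ :=
  ⟨hφ.smooth, hφ.compact, hφ.support_subset.trans h⟩

lemma IsTestFunction.support_subset' {φ : Space N → ℝ} (hφ : IsTestFunction Ω φ) :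
    Function.support φ ⊆ Ω := (subset_tsupport φ).trans hφ.support_subset

lemma IsTestFunction.support_gradient {φ : Space N → ℝ} (hφ : IsTestFunction Ω φ) :
    Function.support (∇ φ) ⊆ Ω := by
  intro x hx
  refine hφ.support_subset (support_fderiv_subset ℝ fun h => hx ?_)
  rw [← norm_eq_zero, norm_gradient, h, norm_zero]

/-- A bound on the `L^p` norm in terms of the `H¹` quantities extends from test functions
to `H₀¹(Ω)`. -/
lemma eLpNorm_le_of_testGraph {p : ℝ≥0∞} {K a b : ℝ} (ha : 0 ≤ a) (hb : 0 ≤ b)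
    (h : ∀ U ∈ testGraph Ω, eLpNorm U.fst p (volume.restrict Ω) ≤
      ENNReal.ofReal (K * ‖U.fst‖ ^ a * ‖U.snd‖ ^ b)) (u : H01 Ω) :
    eLpNorm (fn u) p (volume.restrict Ω) ≤
      ENNReal.ofReal (K * ‖fn u‖ ^ a * ‖grad u‖ ^ b) := by
  have hu : u.1 ∈ closure (testGraph Ω : Set (L2Pair Ω)) := u.2
  obtain ⟨V, hV, hlim⟩ := mem_closure_iff_seq_limit.1 hu
  have c1 : Continuous (fun U : L2Pair Ω => U.fst) :=
    continuous_fst.comp (WithLp.prod_continuous_ofLp 2 _ _)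
  have c2 : Continuous (fun U : L2Pair Ω => U.snd) :=
    continuous_snd.comp (WithLp.prod_continuous_ofLp 2 _ _)
  have l1 : Tendsto (fun n => (V n).fst) atTop (𝓝 (fn u)) := (c1.tendsto _).comp hlim
  have l2 : Tendsto (fun n => (V n).snd) atTop (𝓝 (grad u)) := (c2.tendsto _).comp hlim
  -- Convergence in L^p is not yet known. L² convergence gives an a.e. convergent subsequence, and
  -- Fatou then bounds the left side; the right side converges along it because a, b ≥ 0.
  obtain ⟨ns, hns, hae⟩ := (tendstoInMeasure_of_tendsto_Lp l1).exists_seq_tendsto_ae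
  refine (Lp.eLpNorm_lim_le_liminf_eLpNorm
    (fun n => Lp.aestronglyMeasurable (V (ns n)).fst) _ hae).trans ?_
  have hl : Tendsto (fun n => ENNReal.ofReal (K * ‖(V (ns n)).fst‖ ^ a * ‖(V (ns n)).snd‖ ^ b))
      atTop (𝓝 (ENNReal.ofReal (K * ‖fn u‖ ^ a * ‖grad u‖ ^ b))) := by
    refine ENNReal.tendsto_ofReal ?_
    refine Tendsto.mul (Tendsto.mul tendsto_const_nhds ?_) ?_
    · exact ((l1.comp hns.tendsto_atTop).norm).rpow_const (Or.inr ha)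
    · exact ((l2.comp hns.tendsto_atTop).norm).rpow_const (Or.inr hb)
  rw [← hl.liminf_eq]
  exact liminf_le_liminf (Eventually.of_forall fun n => h _ (hV _))

lemma mass_eq_norm_sq (u : H01 Ω) : mass u = ‖fn u‖ ^ 2 := by
  rw [mass, ← real_inner_self_eq_norm_sq, L2.inner_def]
  simp [sq]

lemma dirichlet_eq_norm_sq (u : H01 Ω) : dirichlet u = ‖grad u‖ ^ 2 := by
  rw [dirichlet, ← real_inner_self_eq_norm_sq, L2.inner_def]
  simp

lemma mass_nonneg (u : H01 Ω) : 0 ≤ mass u := by rw [mass_eq_norm_sq]; positivity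

lemma dirichlet_nonneg (u : H01 Ω) : 0 ≤ dirichlet u := by rw [dirichlet_eq_norm_sq]; positivity

lemma IsTestFunction.mass_toH01 {φ : Space N → ℝ} (hφ : IsTestFunction Ω φ) :
    mass hφ.toH01 = ∫ x, φ x ^ 2 := by
  rw [mass, ← setIntegral_eq_integral_of_forall_compl_eq_zero (s := Ω) (f := fun x => φ x ^ 2)]
  · refine integral_congr_ae ?_
    filter_upwards [hφ.fn_toH01] with x hx
    rw [hx]
  · intro x hx
    rw [Function.notMem_support.1 fun h => hx (hφ.support_subset' h)]
    simp

lemma IsTestFunction.dirichlet_toH01 {φ : Space N → ℝ} (hφ : IsTestFunction Ω φ) :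
    dirichlet hφ.toH01 = ∫ x, ‖∇ φ x‖ ^ 2 := by
  rw [dirichlet, ← setIntegral_eq_integral_of_forall_compl_eq_zero (s := Ω)
    (f := fun x => ‖∇ φ x‖ ^ 2)]
  · refine integral_congr_ae ?_
    filter_upwards [hφ.grad_toH01] with x hx
    rw [hx]
  · intro x hx
    rw [Function.notMem_support.1 fun h => hx (hφ.support_gradient h)]
    simp

lemma IsTestFunction.norm_fn_toH01 {φ : Space N → ℝ} (hφ : IsTestFunction Ω φ) :
    ‖fn hφ.toH01‖ = (eLpNorm φ 2 volume).toReal := by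
  rw [Lp.norm_def, eLpNorm_congr_ae hφ.fn_toH01,
    eLpNorm_restrict_eq_of_support_subset hφ.support_subset']

lemma IsTestFunction.norm_grad_toH01 {φ : Space N → ℝ} (hφ : IsTestFunction Ω φ) :
    ‖grad hφ.toH01‖ = (eLpNorm (∇ φ) 2 volume).toReal := by
  rw [Lp.norm_def, eLpNorm_congr_ae hφ.grad_toH01,
    eLpNorm_restrict_eq_of_support_subset hφ.support_gradient]

lemma IsTestFunction.eLpNorm_fn_toH01 {φ : Space N → ℝ} (hφ : IsTestFunction Ω φ) (p : ℝ≥0∞) :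
    eLpNorm (fn hφ.toH01) p (volume.restrict Ω) = eLpNorm φ p volume := by
  rw [eLpNorm_congr_ae hφ.fn_toH01, eLpNorm_restrict_eq_of_support_subset hφ.support_subset']

/-- It suffices to bound the elements of `H₀¹(Ω)` coming from test functions. -/
lemma eLpNorm_le_of_isTestFunction {p : ℝ≥0∞} {K a b : ℝ} (ha : 0 ≤ a) (hb : 0 ≤ b)
    (h : ∀ φ : Space N → ℝ, IsTestFunction Ω φ → eLpNorm φ p volume ≤
      ENNReal.ofReal (K * (eLpNorm φ 2 volume).toReal ^ a * (eLpNorm (∇ φ) 2 volume).toReal ^ b))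
    (u : H01 Ω) :
    eLpNorm (fn u) p (volume.restrict Ω) ≤
      ENNReal.ofReal (K * ‖fn u‖ ^ a * ‖grad u‖ ^ b) := by
  refine eLpNorm_le_of_testGraph ha hb ?_ u
  rintro U ⟨φ, hφ, h1, h2⟩
  rw [Lp.norm_def, Lp.norm_def, eLpNorm_congr_ae h1, eLpNorm_congr_ae h1, eLpNorm_congr_ae h2,
    eLpNorm_restrict_eq_of_support_subset hφ.support_subset',
    eLpNorm_restrict_eq_of_support_subset hφ.support_subset',
    eLpNorm_restrict_eq_of_support_subset hφ.support_gradient]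
  exact h φ hφ

lemma integral_abs_rpow_eq {X : Type*} [MeasurableSpace X] {ν : Measure X} {f : X → ℝ} {p : ℝ}
    (hp : 0 < p) (hf : MemLp f (ENNReal.ofReal p) ν) :
    ∫ x, |f x| ^ p ∂ν = (eLpNorm f (ENNReal.ofReal p) ν).toReal ^ p := by
  have h0 : 0 ≤ ∫ x, |f x| ^ p ∂ν := integral_nonneg fun x => by positivity
  rw [hf.eLpNorm_eq_integral_rpow_norm (by simpa using hp) ENNReal.ofReal_ne_top,
    ENNReal.toReal_ofReal hp.le]
  simp_rw [Real.norm_eq_abs]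
  rw [ENNReal.toReal_ofReal (by positivity), ← Real.rpow_mul h0, inv_mul_cancel₀ hp.ne',
    Real.rpow_one]

/-! ### The Gagliardo–Nirenberg inequality and its optimal constant -/

/-- The Gagliardo-Nirenberg exponents are in range. -/
lemma gammaExp_bounds (hN : 3 ≤ N) {p : ℝ} (hp₁ : 2 + 4 / (N : ℝ) < p)
    (hp₂ : p < 2 * (N : ℝ) / ((N : ℝ) - 2)) :
    2 < p ∧ 2 < p * gammaExp N p ∧ 0 < gammaExp N p ∧ gammaExp N p < 1 := by
  have hN' : (3 : ℝ) ≤ N := by exact_mod_cast hN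
  have hp : 2 < p := lt_trans (by have : 0 < 4 / (N : ℝ) := by positivity
                                  linarith) hp₁
  have e : p * gammaExp N p = N * (p - 2) / 2 := by
    rw [gammaExp]
    field_simp
  -- As pγ_p = N(p-2)/2, the lower bound on p says exactly pγ_p > 2; the upper bound says exactly
  -- γ_p < 1.
  have h4 : 2 < p * gammaExp N p := by
    have : 4 / (N : ℝ) < p - 2 := by linarith
    rw [div_lt_iff₀ (by linarith)] at this
    rw [e]
    linarith
  refine ⟨hp, h4, by by_contra! h; nlinarith, ?_⟩
  rw [lt_div_iff₀ (by linarith)] at hp₂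
  rw [gammaExp, div_lt_one (by linarith)]
  linarith

/-- The Gagliardo-Nirenberg inequality for test functions. -/
lemma exists_eLpNorm_le_of_isTestFunction (hN : 3 ≤ N) {p : ℝ} (hp₁ : 2 + 4 / (N : ℝ) < p)
    (hp₂ : p < 2 * (N : ℝ) / ((N : ℝ) - 2)) :
    ∃ K : ℝ, 0 ≤ K ∧ ∀ φ : Space N → ℝ, IsTestFunction univ φ →
      eLpNorm φ (ENNReal.ofReal p) volume ≤
        ENNReal.ofReal (K * (eLpNorm φ 2 volume).toReal ^ (1 - gammaExp N p) *
          (eLpNorm (∇ φ) 2 volume).toReal ^ gammaExp N p) := by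
  obtain ⟨hp, -, hγ0, hγ1⟩ := gammaExp_bounds hN hp₁ hp₂
  have hN' : (3 : ℝ) ≤ N := by exact_mod_cast hN
  set γ := gammaExp N p with hγ
  -- The critical Sobolev exponent, 1/q = 1/2 - 1/N. With it, γ_p is the interpolation weight: 1/p =
  -- (1-γ_p)/2 + γ_p/q.
  set q : ℝ := 2 * N / (N - 2) with hq
  have hq0 : 0 < q := div_pos (by linarith) (by linarith)
  set S : ℝ≥0 := SNormLESNormFDerivOfEqConst ℝ (volume : Measure (Space N)) 2 with hS
  refine ⟨(S : ℝ) ^ γ, by positivity, fun φ hφ => ?_⟩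
  have m2 : MemLp φ 2 volume := by simpa using hφ.memLp 2 univ
  have mg : MemLp (∇ φ) 2 volume := by simpa using hφ.memLp_gradient 2 univ
  have sob : eLpNorm φ (ENNReal.ofReal q) volume ≤ S * eLpNorm (∇ φ) 2 volume := by
    have := eLpNorm_le_eLpNorm_fderiv_of_eq (volume : Measure (Space N)) (F := ℝ)
      (u := φ) (hφ.smooth.of_le (by simp)) hφ.compact (p := 2) (p' := q.toNNReal)
      (by norm_num) (by simp; omega) (by
        rw [Real.coe_toNNReal _ hq0.le, hq]
        simp only [NNReal.coe_inv, NNReal.coe_ofNat, finrank_euclideanSpace, Fintype.card_fin]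
        have : (N : ℝ) - 2 ≠ 0 := by linarith
        field_simp)
    have e : eLpNorm (fderiv ℝ φ) 2 volume = eLpNorm (∇ φ) 2 volume :=
      eLpNorm_congr_norm_ae (Eventually.of_forall fun x => (norm_gradient φ x).symm)
    rw [← e]
    exact this
  have int := eLpNorm_le_eLpNorm_rpow_mul_eLpNorm_rpow (ν := volume) m2.1 (r := 2) (q := q)
    (p := p) (θ := γ) (by norm_num) hq0 (by linarith) hγ0.le hγ1.le (by
      rw [hγ, gammaExp, hq]
      have : (N : ℝ) - 2 ≠ 0 := by linarith
      field_simp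
      ring)
  have e2 : ENNReal.ofReal (2 : ℝ) = 2 := by simp
  rw [e2] at int
  refine int.trans ?_
  have t : ENNReal.ofReal ((S : ℝ) ^ γ * (eLpNorm φ 2 volume).toReal ^ (1 - γ) *
          (eLpNorm (∇ φ) 2 volume).toReal ^ γ) =
      eLpNorm φ 2 volume ^ (1 - γ) * (S * eLpNorm (∇ φ) 2 volume) ^ γ := by
    rw [ENNReal.ofReal_mul (by positivity), ENNReal.ofReal_mul (by positivity),
      ← ENNReal.ofReal_rpow_of_nonneg (by positivity) hγ0.le,
      ← ENNReal.ofReal_rpow_of_nonneg (by positivity) (by linarith),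
      ← ENNReal.ofReal_rpow_of_nonneg (by positivity) hγ0.le, ENNReal.ofReal_toReal m2.2.ne,
      ENNReal.ofReal_toReal mg.2.ne, ENNReal.ofReal_coe_nnreal,
      ENNReal.mul_rpow_of_nonneg _ _ hγ0.le]
    ring
  rw [t]
  gcongr

/-- Elements of `H₀¹(Ω)` are in `L^p` for subcritical `p`. -/
lemma exists_eLpNorm_fn_le (hN : 3 ≤ N) {p : ℝ} (hp₁ : 2 + 4 / (N : ℝ) < p)
    (hp₂ : p < 2 * (N : ℝ) / ((N : ℝ) - 2)) :
    ∃ K : ℝ, 0 ≤ K ∧ ∀ (Ω : Set (Space N)) (u : H01 Ω),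
      eLpNorm (fn u) (ENNReal.ofReal p) (volume.restrict Ω) ≤
        ENNReal.ofReal (K * ‖fn u‖ ^ (1 - gammaExp N p) * ‖grad u‖ ^ gammaExp N p) := by
  obtain ⟨-, -, hγ0, hγ1⟩ := gammaExp_bounds hN hp₁ hp₂
  obtain ⟨K, hK, h⟩ := exists_eLpNorm_le_of_isTestFunction hN hp₁ hp₂
  exact ⟨K, hK, fun Ω u => eLpNorm_le_of_isTestFunction (by linarith) hγ0.le
    (fun φ hφ => h φ (hφ.mono (subset_univ _))) u⟩

lemma memLp_fn (hN : 3 ≤ N) {p : ℝ} (hp₁ : 2 + 4 / (N : ℝ) < p)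
    (hp₂ : p < 2 * (N : ℝ) / ((N : ℝ) - 2)) (u : H01 Ω) :
    MemLp (fn u) (ENNReal.ofReal p) (volume.restrict Ω) := by
  obtain ⟨K, -, h⟩ := exists_eLpNorm_fn_le hN hp₁ hp₂
  exact ⟨Lp.aestronglyMeasurable _, (h Ω u).trans_lt ENNReal.ofReal_lt_top⟩

/-- Taking p-th roots turns the integral inequality into the norm form to which the density argument
applies. -/
lemma integral_le_iff_eLpNorm_le {p γ C : ℝ} (hp : 0 < p) (hC : 0 ≤ C) (u : H01 Ω)
    (hu : MemLp (fn u) (ENNReal.ofReal p) (volume.restrict Ω)) :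
    ∫ x in Ω, |(fn u) x| ^ p ≤
      C * mass u ^ (p * (1 - γ) / 2) * dirichlet u ^ (p * γ / 2) ↔
    eLpNorm (fn u) (ENNReal.ofReal p) (volume.restrict Ω) ≤
      ENNReal.ofReal (C ^ (1 / p) * ‖fn u‖ ^ (1 - γ) * ‖grad u‖ ^ γ) := by
  have e : C * mass u ^ (p * (1 - γ) / 2) * dirichlet u ^ (p * γ / 2) =
      (C ^ (1 / p) * ‖fn u‖ ^ (1 - γ) * ‖grad u‖ ^ γ) ^ p := by
    rw [Real.mul_rpow (by positivity) (by positivity),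
      Real.mul_rpow (by positivity) (by positivity), ← Real.rpow_mul hC,
      ← Real.rpow_mul (norm_nonneg _), ← Real.rpow_mul (norm_nonneg _), mass_eq_norm_sq,
      dirichlet_eq_norm_sq, ← Real.rpow_natCast, ← Real.rpow_natCast, ← Real.rpow_mul (norm_nonneg _),
      ← Real.rpow_mul (norm_nonneg _), one_div_mul_cancel hp.ne', Real.rpow_one]
    congr 2
    · congr 1
      push_cast
      ring
    · push_cast
      ring
  rw [integral_abs_rpow_eq hp hu, e,
    Real.rpow_le_rpow_iff ENNReal.toReal_nonneg (by positivity) hp,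
    ENNReal.le_ofReal_iff_toReal_le hu.2.ne (by positivity)]

/-- A nonnegative bump function with support in the unit ball. -/
def unitBump (N : ℕ) : ContDiffBump (0 : Space N) := ⟨1 / 2, 1, by norm_num, by norm_num⟩

lemma isTestFunction_unitBump (N : ℕ) : IsTestFunction univ (unitBump N : Space N → ℝ) :=
  ⟨(unitBump N).contDiff, (unitBump N).hasCompactSupport, subset_univ _⟩

lemma integral_unitBump_rpow_pos {p : ℝ} (hp : 0 < p) :
    0 < ∫ x, |unitBump N x| ^ p := by
  have hc : Continuous fun x => |unitBump N x| ^ p :=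
    (unitBump N).continuous.abs.rpow_const fun _ => Or.inr hp.le
  refine hc.integral_pos_of_hasCompactSupport_nonneg_nonzero (x := 0)
    ?_ (fun x => by positivity) ?_
  · exact (unitBump N).hasCompactSupport.comp_left (g := fun t : ℝ => |t| ^ p)
      (by simp [Real.zero_rpow hp.ne'])
  · have : unitBump N 0 = 1 := (unitBump N).one_of_mem_closedBall
      (by simp [(unitBump N).rIn_pos.le])
    simp [this]

lemma gnConst_nonneg (N : ℕ) (p : ℝ) : 0 ≤ gnConst N p := Real.sInf_nonneg fun _ h => h.1

/-- The optimal constant is attained in the sense that the inequality holds with it. -/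
lemma integral_le_gnConst_mul (hN : 3 ≤ N) {p : ℝ} (hp₁ : 2 + 4 / (N : ℝ) < p)
    (hp₂ : p < 2 * (N : ℝ) / ((N : ℝ) - 2)) (w : H01 (univ : Set (Space N))) :
    ∫ x in univ, |(fn w) x| ^ p ≤ gnConst N p * mass w ^ (p * (1 - gammaExp N p) / 2) *
      dirichlet w ^ (p * gammaExp N p / 2) := by
  have hp := (gammaExp_bounds hN hp₁ hp₂).1
  set M := mass w ^ (p * (1 - gammaExp N p) / 2) * dirichlet w ^ (p * gammaExp N p / 2) with hM
  have hM0 : 0 ≤ M := by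
    have := mass_nonneg w
    have := dirichlet_nonneg w
    positivity
  set A := {C : ℝ | 0 ≤ C ∧ ∀ w : H01 (univ : Set (Space N)),
    ∫ x in univ, |(fn w) x| ^ p ≤
      C * mass w ^ (p * (1 - gammaExp N p) / 2) * dirichlet w ^ (p * gammaExp N p / 2)} with hA
  have hne : A.Nonempty := by
    obtain ⟨K, hK, h⟩ := exists_eLpNorm_fn_le hN hp₁ hp₂
    refine ⟨K ^ p, by positivity, fun w => ?_⟩
    rw [integral_le_iff_eLpNorm_le (by linarith) (by positivity) w (memLp_fn hN hp₁ hp₂ w),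
      ← Real.rpow_mul hK, mul_one_div_cancel (by linarith), Real.rpow_one]
    exact h _ w
  rw [mul_assoc, ← hM]
  have hbound : ∀ C ∈ A, ∫ x in univ, |(fn w) x| ^ p ≤ C * M := by
    intro C hC
    rw [hM, ← mul_assoc]
    exact hC.2 w
  -- If M = 0, any admissible constant already gives the claim. Otherwise the integral divided by M
  -- is a lower bound of the admissible set, hence below its infimum.
  rcases hM0.eq_or_lt with h0 | h0
  · obtain ⟨C, hC⟩ := hne
    have := hbound C hC
    rw [← h0, mul_zero] at this ⊢
    exact this
  · rw [← div_le_iff₀ h0]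
    exact le_csInf hne fun C hC => (div_le_iff₀ h0).2 (hbound C hC)

/-- The Gagliardo-Nirenberg inequality on `H₀¹(Ω)` with the constant of the whole space. -/
lemma integral_le_gnConst_mul_of_H01 (hN : 3 ≤ N) {p : ℝ} (hp₁ : 2 + 4 / (N : ℝ) < p)
    (hp₂ : p < 2 * (N : ℝ) / ((N : ℝ) - 2)) (u : H01 Ω) :
    ∫ x in Ω, |(fn u) x| ^ p ≤ gnConst N p * mass u ^ (p * (1 - gammaExp N p) / 2) *
      dirichlet u ^ (p * gammaExp N p / 2) := by
  obtain ⟨hp, -, hγ0, hγ1⟩ := gammaExp_bounds hN hp₁ hp₂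
  rw [integral_le_iff_eLpNorm_le (by linarith) (gnConst_nonneg N p) u (memLp_fn hN hp₁ hp₂ u)]
  -- A test function on Ω is one on the whole space with the same norms, so the whole-space constant
  -- suffices.
  refine eLpNorm_le_of_isTestFunction (by linarith) hγ0.le (fun φ hφ => ?_) u
  have hφ' := hφ.mono (subset_univ _)
  have := integral_le_gnConst_mul hN hp₁ hp₂ hφ'.toH01
  rw [integral_le_iff_eLpNorm_le (by linarith) (gnConst_nonneg N p) _ (memLp_fn hN hp₁ hp₂ _),
    hφ'.eLpNorm_fn_toH01, hφ'.norm_fn_toH01, hφ'.norm_grad_toH01] at this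
  exact this

lemma IsTestFunction.integral_toH01 {φ : Space N → ℝ} (hφ : IsTestFunction Ω φ) {p : ℝ}
    (hp : 0 < p) : ∫ x in Ω, |fn hφ.toH01 x| ^ p = ∫ x, |φ x| ^ p := by
  rw [← setIntegral_eq_integral_of_forall_compl_eq_zero (s := Ω) (f := fun x => |φ x| ^ p)]
  · refine integral_congr_ae ?_
    filter_upwards [hφ.fn_toH01] with x hx
    rw [hx]
  · intro x hx
    rw [Function.notMem_support.1 fun h => hx (hφ.support_subset' h)]
    simp [Real.zero_rpow hp.ne']

/-- The bump has positive L^p integral, so no factor on the right of Gagliardo–Nirenberg can vanish.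
The constant is a denominator in k₀, and the Dirichlet integral fixes the scaling of the endpoints.
-/
lemma gnConst_mul_dirichlet_unitBump_pos (hN : 3 ≤ N) {p : ℝ} (hp₁ : 2 + 4 / (N : ℝ) < p)
    (hp₂ : p < 2 * (N : ℝ) / ((N : ℝ) - 2)) :
    0 < gnConst N p ∧ 0 < ∫ x, ‖∇ (unitBump N : Space N → ℝ) x‖ ^ 2 := by
  obtain ⟨hp, -, hγ0, hγ1⟩ := gammaExp_bounds hN hp₁ hp₂
  have hφ := isTestFunction_unitBump N
  have h := integral_le_gnConst_mul hN hp₁ hp₂ hφ.toH01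
  rw [hφ.integral_toH01 (by linarith), hφ.dirichlet_toH01] at h
  have h' := (integral_unitBump_rpow_pos (N := N) (p := p) (by linarith)).trans_le h
  constructor
  · refine (gnConst_nonneg N p).lt_of_ne' fun h0 => ?_
    simp [h0] at h'
  · refine (integral_nonneg fun x => by positivity).lt_of_ne' fun h0 => ?_
    rw [h0, Real.zero_rpow (by positivity), mul_zero] at h'
    exact h'.false

/-! ### Continuity of the energy -/

lemma norm_rpow_neg_le {r₀ α : ℝ} (hr₀ : 0 < r₀) (hα : 0 < α) {x : Space N} (hx : r₀ ≤ ‖x‖) :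
    ‖x‖ ^ (-α) ≤ r₀ ^ (-α) :=
  Real.rpow_le_rpow_of_nonpos hr₀ hx (by linarith)

/-- Multiplication by `|x|^{-α/p}` is bounded on `L^p(Ω)`. -/
lemma memLp_weight_mul {p r₀ α : ℝ} (hr₀ : 0 < r₀) (hα : 0 < α) (hp : 0 < p)
    (hΩ : MeasurableSet Ω) (hΩr : ∀ x ∈ Ω, r₀ ≤ ‖x‖) {f : Space N → ℝ}
    (hf : MemLp f (ENNReal.ofReal p) (volume.restrict Ω)) :
    MemLp (fun x => ‖x‖ ^ (-(α / p)) * f x) (ENNReal.ofReal p) (volume.restrict Ω) ∧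
    eLpNorm (fun x => ‖x‖ ^ (-(α / p)) * f x) (ENNReal.ofReal p) (volume.restrict Ω) ≤
      ENNReal.ofReal (r₀ ^ (-(α / p))) * eLpNorm f (ENNReal.ofReal p) (volume.restrict Ω) := by
  have hm : AEStronglyMeasurable (fun x => ‖x‖ ^ (-(α / p)) * f x) (volume.restrict Ω) :=
    ((measurable_norm.pow_const _).aestronglyMeasurable).mul hf.1
  have hb : ∀ᵐ x ∂(volume.restrict Ω), ‖‖x‖ ^ (-(α / p)) * f x‖ ≤ r₀ ^ (-(α / p)) * ‖f x‖ := by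
    filter_upwards [ae_restrict_mem hΩ] with x hx
    rw [norm_mul, Real.norm_of_nonneg (by positivity)]
    exact mul_le_mul_of_nonneg_right (norm_rpow_neg_le hr₀ (by positivity) (hΩr x hx))
      (norm_nonneg _)
  exact ⟨MemLp.of_le_mul hf hm hb, eLpNorm_le_mul_eLpNorm_of_ae_le_mul hb _⟩

lemma abs_weight_mul_rpow {p α : ℝ} (hp : 0 < p) (x : Space N) (t : ℝ) :
    |‖x‖ ^ (-(α / p)) * t| ^ p = ‖x‖ ^ (-α) * |t| ^ p := by
  rw [abs_mul, Real.mul_rpow (abs_nonneg _) (abs_nonneg _), abs_of_nonneg (by positivity),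
    ← Real.rpow_mul (norm_nonneg _)]
  congr 2
  field_simp

lemma fn_add (u v : H01 Ω) : fn (u + v) = fn u + fn v := rfl
lemma fn_sub (u v : H01 Ω) : fn (u - v) = fn u - fn v := rfl
lemma fn_smul (c : ℝ) (u : H01 Ω) : fn (c • u) = c • fn u := rfl

lemma continuous_fn : Continuous (fun u : H01 Ω => fn u) :=
  (continuous_fst.comp (WithLp.prod_continuous_ofLp 2 _ _)).comp continuous_subtype_val

lemma continuous_grad : Continuous (fun u : H01 Ω => grad u) :=
  (continuous_snd.comp (WithLp.prod_continuous_ofLp 2 _ _)).comp continuous_subtype_val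

lemma continuous_mass : Continuous (fun u : H01 Ω => mass u) := by
  simp_rw [mass_eq_norm_sq]
  exact continuous_fn.norm.pow 2

lemma continuous_dirichlet : Continuous (fun u : H01 Ω => dirichlet u) := by
  simp_rw [dirichlet_eq_norm_sq]
  exact continuous_grad.norm.pow 2

/-- The integral is the p-th power of the L^p norm of |x|^(-α/p) u. This weighted function depends
linearly on u, and Gagliardo–Nirenberg applied to v - u controls its increments. -/
lemma continuous_weighted_integral (hN : 3 ≤ N) {p r₀ α : ℝ} (hp₁ : 2 + 4 / (N : ℝ) < p)
    (hp₂ : p < 2 * (N : ℝ) / ((N : ℝ) - 2)) (hr₀ : 0 < r₀) (hα : 0 < α)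
    (hΩ : MeasurableSet Ω) (hΩr : ∀ x ∈ Ω, r₀ ≤ ‖x‖) :
    Continuous (fun u : H01 Ω => ∫ x in Ω, ‖x‖ ^ (-α) * |(fn u) x| ^ p) := by
  obtain ⟨hp, -, hγ0, hγ1⟩ := gammaExp_bounds hN hp₁ hp₂
  have hp0 : 0 < p := by linarith
  have : Fact (1 ≤ ENNReal.ofReal p) := ⟨by simp; linarith⟩
  have hm := fun u : H01 Ω =>
    (memLp_weight_mul hr₀ hα hp0 hΩ hΩr (memLp_fn hN hp₁ hp₂ u)).1
  have e : (fun u : H01 Ω => ∫ x in Ω, ‖x‖ ^ (-α) * |(fn u) x| ^ p) =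
      fun u => ‖(hm u).toLp _‖ ^ p := by
    ext1 u
    rw [Lp.norm_toLp, ← integral_abs_rpow_eq hp0 (hm u)]
    simp_rw [abs_weight_mul_rpow hp0]
  rw [e]
  refine Continuous.rpow_const (Continuous.norm ?_) fun _ => Or.inr hp0.le
  obtain ⟨K, hK, h⟩ := exists_eLpNorm_fn_le hN hp₁ hp₂
  rw [continuous_iff_continuousAt]
  intro u
  rw [ContinuousAt, tendsto_iff_norm_sub_tendsto_zero]
  have hb : ∀ v : H01 Ω, ‖(hm v).toLp _ - (hm u).toLp _‖ ≤
      r₀ ^ (-(α / p)) * (K * ‖fn (v - u)‖ ^ (1 - gammaExp N p) *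
        ‖grad (v - u)‖ ^ gammaExp N p) := by
    intro v
    rw [← MemLp.toLp_sub, Lp.norm_toLp]
    refine ENNReal.toReal_le_of_le_ofReal (by positivity) ?_
    rw [ENNReal.ofReal_mul (by positivity)]
    refine le_trans (le_of_eq (eLpNorm_congr_ae ?_))
      ((memLp_weight_mul hr₀ hα hp0 hΩ hΩr (memLp_fn hN hp₁ hp₂ (v - u))).2.trans
        (by gcongr; exact h Ω (v - u)))
    filter_upwards [Lp.coeFn_sub (fn v) (fn u)] with x hx
    rw [fn_sub, hx]
    simp only [Pi.sub_apply]
    ring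
  refine squeeze_zero (fun _ => norm_nonneg _) hb ?_
  have c : Continuous fun v : H01 Ω => r₀ ^ (-(α / p)) *
      (K * ‖fn (v - u)‖ ^ (1 - gammaExp N p) * ‖grad (v - u)‖ ^ gammaExp N p) := by
    have c0 : Continuous fun v : H01 Ω => v - u := continuous_id.sub continuous_const
    refine continuous_const.mul ((continuous_const.mul ?_).mul ?_)
    · exact (continuous_fn.comp c0).norm.rpow_const fun _ => Or.inr (by linarith)
    · exact (continuous_grad.comp c0).norm.rpow_const fun _ => Or.inr hγ0.le
  have := c.tendsto u
  -- The gradient factor alone forces the limit 0, since γ_p > 0.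
  have z : grad (u - u) = 0 := by rw [sub_self]; rfl
  rw [z, norm_zero, Real.zero_rpow hγ0.ne', mul_zero, mul_zero] at this
  exact this

lemma integrableOn_weighted (hN : 3 ≤ N) {p r₀ α : ℝ} (hp₁ : 2 + 4 / (N : ℝ) < p)
    (hp₂ : p < 2 * (N : ℝ) / ((N : ℝ) - 2)) (hr₀ : 0 < r₀) (hα : 0 < α)
    (hΩ : MeasurableSet Ω) (hΩr : ∀ x ∈ Ω, r₀ ≤ ‖x‖) (u : H01 Ω) :
    IntegrableOn (fun x => ‖x‖ ^ (-α) * |(fn u) x| ^ p) Ω := by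
  have hp0 : 0 < p := by linarith [(gammaExp_bounds hN hp₁ hp₂).1]
  have hm := (memLp_weight_mul hr₀ hα hp0 hΩ hΩr (memLp_fn hN hp₁ hp₂ u)).1
  have := hm.integrable_norm_rpow (by simpa using hp0) ENNReal.ofReal_ne_top
  rw [ENNReal.toReal_ofReal hp0.le] at this
  simp_rw [Real.norm_eq_abs, abs_weight_mul_rpow hp0] at this
  exact this

lemma integrableOn_abs_rpow (hN : 3 ≤ N) {p : ℝ} (hp₁ : 2 + 4 / (N : ℝ) < p)
    (hp₂ : p < 2 * (N : ℝ) / ((N : ℝ) - 2)) (u : H01 Ω) :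
    IntegrableOn (fun x => |(fn u) x| ^ p) Ω := by
  have hp0 : 0 < p := by linarith [(gammaExp_bounds hN hp₁ hp₂).1]
  have := (memLp_fn hN hp₁ hp₂ u).integrable_norm_rpow (by simpa using hp0) ENNReal.ofReal_ne_top
  rw [ENNReal.toReal_ofReal hp0.le] at this
  exact this

lemma weighted_integral_nonneg {α p : ℝ} (u : H01 Ω) :
    0 ≤ ∫ x in Ω, ‖x‖ ^ (-α) * |(fn u) x| ^ p := integral_nonneg fun x => by positivity

lemma continuous_energy (hN : 3 ≤ N) {p r₀ α : ℝ} (hp₁ : 2 + 4 / (N : ℝ) < p)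
    (hp₂ : p < 2 * (N : ℝ) / ((N : ℝ) - 2)) (hr₀ : 0 < r₀) (hα : 0 < α)
    (hΩ : MeasurableSet Ω) (hΩr : ∀ x ∈ Ω, r₀ ≤ ‖x‖) (ρ : ℝ) :
    Continuous (fun u : H01 Ω => energy α p ρ u) :=
  (continuous_const.mul continuous_dirichlet).sub
    (continuous_const.mul (continuous_weighted_integral hN hp₁ hp₂ hr₀ hα hΩ hΩr))

/-! ### The energy barrier at Dirichlet integral k₀ -/

lemma kZero_pos (hN : 3 ≤ N) {p r₀ α μ : ℝ} (hp₁ : 2 + 4 / (N : ℝ) < p)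
    (hp₂ : p < 2 * (N : ℝ) / ((N : ℝ) - 2)) (hr₀ : 0 < r₀) (hμ : 0 < μ) :
    0 < kZero N α p r₀ μ := by
  have hC := (gnConst_mul_dirichlet_unitBump_pos hN hp₁ hp₂).1
  have hp := (gammaExp_bounds hN hp₁ hp₂).1
  have : 0 < p := by linarith
  unfold kZero
  positivity

/-- On the set where the Dirichlet integral equals `k₀`, the energy is at least `k₀ / 4`. -/
lemma kZero_div_four_le_energy (hN : 3 ≤ N) {p r₀ α μ ρ : ℝ} (hp₁ : 2 + 4 / (N : ℝ) < p)
    (hp₂ : p < 2 * (N : ℝ) / ((N : ℝ) - 2)) (hr₀ : 0 < r₀) (hα : 0 < α)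
    (hΩ : MeasurableSet Ω) (hΩr : ∀ x ∈ Ω, r₀ ≤ ‖x‖) (hμ : 0 < μ) (hρ : ρ ≤ 1)
    {u : H01 Ω} (hu : mass u = μ) (hk : dirichlet u = kZero N α p r₀ μ) :
    kZero N α p r₀ μ / 4 ≤ energy α p ρ u := by
  obtain ⟨hp, hpγ, hγ0, hγ1⟩ := gammaExp_bounds hN hp₁ hp₂
  have hC := (gnConst_mul_dirichlet_unitBump_pos hN hp₁ hp₂).1
  have hk0 := kZero_pos (α := α) hN hp₁ hp₂ hr₀ hμ
  have hp0 : 0 < p := by linarith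
  set k := kZero N α p r₀ μ with hkdef
  set C := gnConst N p with hCdef
  set γ := gammaExp N p with hγ
  have h1 : ∫ x in Ω, ‖x‖ ^ (-α) * |(fn u) x| ^ p ≤
      r₀ ^ (-α) * ∫ x in Ω, |(fn u) x| ^ p := by
    rw [← integral_const_mul]
    refine setIntegral_mono_on (integrableOn_weighted hN hp₁ hp₂ hr₀ hα hΩ hΩr u)
      ((integrableOn_abs_rpow hN hp₁ hp₂ u).const_mul _) hΩ fun x hx => ?_
    exact mul_le_mul_of_nonneg_right (norm_rpow_neg_le hr₀ hα (hΩr x hx)) (by positivity)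
  have h2 := integral_le_gnConst_mul_of_H01 hN hp₁ hp₂ u
  rw [hu, hk, ← hCdef, ← hγ] at h2
  -- The defining property of k₀: the outer exponent 2/(pγ_p-2) cancels. It makes the
  -- Gagliardo–Nirenberg bound in `h3` equal to pk/4.
  have hkey : k ^ ((p * γ - 2) / 2) = r₀ ^ α * p / (4 * C) * μ ^ (-(p * (1 - γ) / 2)) := by
    have hne : p * γ - 2 ≠ 0 := by linarith
    rw [hkdef, kZero, ← hCdef, ← hγ, Real.mul_rpow (by positivity) (by positivity),
      ← Real.rpow_mul (by positivity), ← Real.rpow_mul hμ.le]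
    congr 1
    · rw [div_mul_div_cancel₀ hne, div_self two_ne_zero, Real.rpow_one]
    · congr 1
      have hne' : γ * p - 2 ≠ 0 := by linarith
      field_simp
  have hsplit : k ^ (p * γ / 2) = k ^ ((p * γ - 2) / 2) * k := by
    nth_rewrite 3 [← Real.rpow_one k]
    rw [← Real.rpow_add hk0]
    congr 1
    ring
  have h3 : r₀ ^ (-α) * (C * μ ^ (p * (1 - γ) / 2) * k ^ (p * γ / 2)) = p * k / 4 := by
    rw [hsplit, hkey, Real.rpow_neg hr₀.le, Real.rpow_neg hμ.le]
    have a1 : r₀ ^ α ≠ 0 := by positivity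
    have a2 : μ ^ (p * (1 - γ) / 2) ≠ 0 := by positivity
    field_simp
  have h4 : ∫ x in Ω, ‖x‖ ^ (-α) * |(fn u) x| ^ p ≤ p * k / 4 := by
    refine h1.trans (le_trans ?_ h3.le)
    gcongr
  have h5 : ρ / p * ∫ x in Ω, ‖x‖ ^ (-α) * |(fn u) x| ^ p ≤ 1 / p * (p * k / 4) := by
    have := weighted_integral_nonneg (α := α) (p := p) u
    gcongr
  have h6 : 1 / p * (p * k / 4) = k / 4 := by field_simp
  rw [energy, hk]
  linarith

/-! ### Rescaled bumps of prescribed mass -/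

/-- The bump `x ↦ A b((x - c) / s)`, supported in the closed ball of radius `s` around `c`. -/
def scaledBump (N : ℕ) (A s : ℝ) (c : Space N) (x : Space N) : ℝ :=
  A * unitBump N (s⁻¹ • (x - c))

lemma isTestFunction_scaledBump (A : ℝ) {s : ℝ} (hs : 0 < s) {c : Space N}
    (h : Metric.closedBall c s ⊆ Ω) : IsTestFunction Ω (scaledBump N A s c) := by
  have hsupp : tsupport (scaledBump N A s c) ⊆ Metric.closedBall c s := by
    refine closure_minimal (fun x hx => ?_) Metric.isClosed_closedBall
    have hx' : s⁻¹ • (x - c) ∈ Function.support (unitBump N) := fun h0 => hx (by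
      simp [scaledBump, h0])
    rw [(unitBump N).support_eq, mem_ball_zero_iff, norm_smul, norm_inv,
      Real.norm_of_nonneg hs.le, inv_mul_lt_iff₀ hs] at hx'
    rw [mem_closedBall_iff_norm]
    simpa [unitBump] using hx'.le
  refine ⟨?_, (isCompact_closedBall c s).of_isClosed_subset (isClosed_tsupport _) hsupp,
    hsupp.trans h⟩
  exact contDiff_const.mul ((unitBump N).contDiff.comp
    ((contDiff_id.sub contDiff_const).const_smul s⁻¹))

lemma integral_comp_scaled (f : Space N → ℝ) {s : ℝ} (hs : 0 < s) (c : Space N) :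
    ∫ x, f (s⁻¹ • (x - c)) = s ^ N * ∫ x, f x := by
  rw [integral_sub_right_eq_self (fun x => f (s⁻¹ • x)) c, Measure.integral_comp_inv_smul,
    finrank_euclideanSpace, Fintype.card_fin, abs_of_nonneg (by positivity), smul_eq_mul]

lemma integral_scaledBump_sq (A : ℝ) {s : ℝ} (hs : 0 < s) (c : Space N) :
    ∫ x, scaledBump N A s c x ^ 2 = A ^ 2 * s ^ N * ∫ x, unitBump N x ^ 2 := by
  simp_rw [scaledBump, mul_pow]
  rw [integral_const_mul, integral_comp_scaled (fun x => unitBump N x ^ 2) hs c]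
  ring

lemma integral_abs_scaledBump_rpow {A : ℝ} (hA : 0 ≤ A) {s : ℝ} (hs : 0 < s) (c : Space N)
    (p : ℝ) : ∫ x, |scaledBump N A s c x| ^ p = A ^ p * s ^ N * ∫ x, |unitBump N x| ^ p := by
  simp_rw [scaledBump, abs_mul, Real.mul_rpow (abs_nonneg _) (abs_nonneg _)]
  rw [integral_const_mul, integral_comp_scaled (fun x => |unitBump N x| ^ p) hs c,
    abs_of_nonneg hA]
  ring

lemma norm_gradient_scaledBump (A : ℝ) {s : ℝ} (hs : 0 < s) (c x : Space N) :
    ‖∇ (scaledBump N A s c) x‖ =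
      |A| * s⁻¹ * ‖∇ (unitBump N : Space N → ℝ) (s⁻¹ • (x - c))‖ := by
  have hd : DifferentiableAt ℝ (unitBump N : Space N → ℝ) (s⁻¹ • (x - c)) :=
    ((unitBump N).contDiff (n := 1)).differentiable (by simp) _
  have h1 : HasFDerivAt (fun y : Space N => s⁻¹ • (y - c))
      (s⁻¹ • ContinuousLinearMap.id ℝ (Space N)) x :=
    ((hasFDerivAt_id x).sub_const c).const_smul s⁻¹
  have h2 := (hd.hasFDerivAt.comp x h1).const_mul A
  have h3 : fderiv ℝ (scaledBump N A s c) x =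
      A • s⁻¹ • fderiv ℝ (unitBump N : Space N → ℝ) (s⁻¹ • (x - c)) := by
    refine h2.fderiv.trans ?_
    ext v
    simp
  rw [norm_gradient, norm_gradient, h3, norm_smul, norm_smul, Real.norm_eq_abs,
    Real.norm_of_nonneg (by positivity)]
  ring

lemma integral_norm_gradient_scaledBump_sq (A : ℝ) {s : ℝ} (hs : 0 < s) (c : Space N) :
    ∫ x, ‖∇ (scaledBump N A s c) x‖ ^ 2 =
      A ^ 2 * s ^ N * (s⁻¹) ^ 2 * ∫ x, ‖∇ (unitBump N : Space N → ℝ) x‖ ^ 2 := by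
  simp_rw [norm_gradient_scaledBump A hs, mul_pow]
  rw [integral_const_mul,
    integral_comp_scaled (fun x => ‖∇ (unitBump N : Space N → ℝ) x‖ ^ 2) hs c, sq_abs]
  ring

lemma integral_unitBump_sq_pos : 0 < ∫ x, unitBump N x ^ 2 := by
  have := integral_unitBump_rpow_pos (N := N) (p := 2) two_pos
  simpa using this

/-- Concentrating and spreading functions of prescribed mass. -/
lemma exists_scaled (hN : 3 ≤ N) {p r₀ α μ : ℝ} (hp₁ : 2 + 4 / (N : ℝ) < p)
    (hp₂ : p < 2 * (N : ℝ) / ((N : ℝ) - 2)) (hr₀ : 0 < r₀) (hα : 0 < α)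
    (hΩ : MeasurableSet Ω) (hΩr : ∀ x ∈ Ω, r₀ ≤ ‖x‖) (hμ : 0 < μ) (R : ℝ) :
    ∃ D > 0, ∃ B > 0, ∀ s > 0, ∀ c : Space N, Metric.closedBall c s ⊆ Ω →
      ∃ u : H01 Ω, mass u = μ ∧ 0 ≤ᵐ[volume.restrict Ω] fn u ∧ dirichlet u = D * s⁻¹ ^ 2 ∧
        (Metric.closedBall c s ⊆ Metric.closedBall 0 R →
          B * s⁻¹ ^ (p * gammaExp N p) ≤ ∫ x in Ω, ‖x‖ ^ (-α) * |(fn u) x| ^ p) := by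
  have hp := (gammaExp_bounds hN hp₁ hp₂).1
  have hp0 : 0 < p := by linarith
  have hm0 := integral_unitBump_sq_pos (N := N)
  have hP0 := integral_unitBump_rpow_pos (N := N) hp0
  have hd0 := (gnConst_mul_dirichlet_unitBump_pos hN hp₁ hp₂).2
  set m0 := ∫ x, unitBump N x ^ 2
  set P0 := ∫ x, |unitBump N x| ^ p
  set d0 := ∫ x, ‖∇ (unitBump N : Space N → ℝ) x‖ ^ 2
  -- On the ball of radius R the weight is at least `(max R 1) ^ (-α)`; the maximum with 1 keeps the
  -- base positive for every real R.
  refine ⟨μ / m0 * d0, by positivity, (max R 1) ^ (-α) * ((μ / m0) ^ (p / 2) * P0),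
    by positivity, fun s hs c hc => ?_⟩
  -- The amplitude normalising the mass: A² s^N m0 = μ.
  set A := √(μ / (s ^ N * m0)) with hA
  have hA2 : A ^ 2 = μ / (s ^ N * m0) := Real.sq_sqrt (by positivity)
  have hφ := isTestFunction_scaledBump A hs hc
  refine ⟨hφ.toH01, ?_, ?_, ?_, fun hR => ?_⟩
  · rw [hφ.mass_toH01, integral_scaledBump_sq A hs, hA2]
    change μ / (s ^ N * m0) * s ^ N * m0 = μ
    field_simp
  · filter_upwards [hφ.fn_toH01] with x hx
    rw [hx]
    exact mul_nonneg (Real.sqrt_nonneg _) (unitBump N).nonneg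
  · rw [hφ.dirichlet_toH01, integral_norm_gradient_scaledBump_sq A hs, hA2]
    change μ / (s ^ N * m0) * s ^ N * s⁻¹ ^ 2 * d0 = _
    field_simp
  · have h1 : ∀ᵐ x ∂(volume.restrict Ω), (max R 1) ^ (-α) * |(fn hφ.toH01) x| ^ p ≤
        ‖x‖ ^ (-α) * |(fn hφ.toH01) x| ^ p := by
      filter_upwards [hφ.fn_toH01, ae_restrict_mem hΩ] with x hx hxΩ
      by_cases h0 : scaledBump N A s c x = 0
      · simp [hx, h0, Real.zero_rpow hp0.ne']
      · have hxb : x ∈ Metric.closedBall c s :=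
          (isTestFunction_scaledBump A hs subset_rfl).support_subset' h0
        refine mul_le_mul_of_nonneg_right ?_ (by positivity)
        refine Real.rpow_le_rpow_of_nonpos (hr₀.trans_le (hΩr x hxΩ)) ?_ (by linarith)
        exact le_max_of_le_left (mem_closedBall_zero_iff.1 (hR hxb))
    have h2 := integral_mono_ae ((integrableOn_abs_rpow hN hp₁ hp₂ hφ.toH01).const_mul _)
      (integrableOn_weighted hN hp₁ hp₂ hr₀ hα hΩ hΩr hφ.toH01) h1
    rw [integral_const_mul, hφ.integral_toH01 hp0,
      integral_abs_scaledBump_rpow (Real.sqrt_nonneg _) hs] at h2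
    refine le_trans (le_of_eq ?_) h2
    have hAp : A ^ p = (μ / m0) ^ (p / 2) * s⁻¹ ^ (N * (p / 2)) := by
      have : A ^ p = (A ^ 2) ^ (p / 2) := by
        rw [← Real.rpow_natCast, ← Real.rpow_mul (Real.sqrt_nonneg _)]
        congr 1
        push_cast
        ring
      rw [this, hA2, mul_comm (s ^ N), ← div_div, div_eq_mul_inv (μ / m0),
        Real.mul_rpow (by positivity) (by positivity), ← inv_pow, ← Real.rpow_natCast s⁻¹ N,
        ← Real.rpow_mul (by positivity)]
    -- The amplitude contributes s^(-Np/2) and the volume s^N; the total exponent is -N(p-2)/2 =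
    -- -pγ_p.
    have hexp : s⁻¹ ^ (N * (p / 2)) * s ^ N = s⁻¹ ^ (p * gammaExp N p) := by
      have : s ^ N = s⁻¹ ^ (-(N : ℝ)) := by
        rw [Real.rpow_neg (by positivity), Real.rpow_natCast, inv_pow, inv_inv]
      rw [this, ← Real.rpow_add (by positivity)]
      congr 1
      rw [gammaExp]
      field_simp
      ring
    change _ = (max R 1) ^ (-α) * (A ^ p * s ^ N * P0)
    rw [hAp, ← hexp]
    ring

/-! ### Paths in the mass sphere -/

/-- The segment between two nonnegative elements of `S_μ` avoids functions of mass zero. -/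
lemma mass_segment_pos {μ : ℝ} (hμ : 0 < μ) {w₁ w₂ : H01 Ω} (e₁ : mass w₁ = μ) (e₂ : mass w₂ = μ)
    (h₁ : 0 ≤ᵐ[volume.restrict Ω] fn w₁) (h₂ : 0 ≤ᵐ[volume.restrict Ω] fn w₂)
    {t : ℝ} (ht0 : 0 ≤ t) (ht1 : t ≤ 1) : 0 < mass ((1 - t) • w₁ + t • w₂) := by
  -- Nonnegativity rules out cancellation: the cross term only adds to ((1-t)² + t²)μ, which is
  -- positive.
  have hinner : 0 ≤ inner ℝ (fn w₁) (fn w₂) := by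
    rw [L2.inner_def]
    refine integral_nonneg_of_ae ?_
    filter_upwards [h₁, h₂] with x hx hx'
    simpa using mul_nonneg hx' hx
  rw [mass_eq_norm_sq] at e₁ e₂ ⊢
  rw [fn_add, fn_smul, fn_smul, norm_add_sq_real, norm_smul, norm_smul,
    real_inner_smul_left, real_inner_smul_right, mul_pow, mul_pow, e₁, e₂,
    Real.norm_eq_abs, Real.norm_eq_abs, sq_abs, sq_abs]
  have a : 0 ≤ 2 * ((1 - t) * (t * inner ℝ (fn w₁) (fn w₂))) :=
    mul_nonneg two_pos.le (mul_nonneg (by linarith) (mul_nonneg ht0 hinner))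
  have b : 0 < ((1 - t) ^ 2 + t ^ 2) * μ :=
    mul_pos (by nlinarith [sq_nonneg (2 * t - 1)]) hμ
  linarith

lemma mass_sqrt_smul {μ : ℝ} (hμ : 0 ≤ μ) {u : H01 Ω} (hu : 0 < mass u) :
    mass (√(μ / mass u) • u) = μ := by
  rw [mass_eq_norm_sq, fn_smul, norm_smul, mul_pow, ← mass_eq_norm_sq, Real.norm_eq_abs, sq_abs,
    Real.sq_sqrt (by positivity), div_mul_cancel₀ _ hu.ne']

/-- Two nonnegative elements of `S_μ` are joined by a path in `S_μ`. -/
lemma nonempty_path_of_nonneg {μ : ℝ} (hμ : 0 < μ) (w₁ w₂ : massSphere Ω μ)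
    (h₁ : 0 ≤ᵐ[volume.restrict Ω] fn w₁.1) (h₂ : 0 ≤ᵐ[volume.restrict Ω] fn w₂.1) :
    Nonempty (Path w₁ w₂) := by
  obtain ⟨w₁, e₁⟩ := w₁
  obtain ⟨w₂, e₂⟩ := w₂
  have e₁' : mass w₁ = μ := e₁
  have e₂' : mass w₂ = μ := e₂
  obtain ⟨seg, hcont, hpos, hs0, hs1⟩ : ∃ seg : unitInterval → H01 Ω, Continuous seg ∧
      (∀ t, 0 < mass (seg t)) ∧ seg 0 = w₁ ∧ seg 1 = w₂ :=
    ⟨fun t => (1 - (t : ℝ)) • w₁ + (t : ℝ) • w₂,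
      ((continuous_const.sub continuous_subtype_val).smul continuous_const).add
        (continuous_subtype_val.smul continuous_const),
      fun t => mass_segment_pos hμ e₁' e₂' h₁ h₂ t.2.1 t.2.2, by simp, by simp⟩
  -- Radial projection of the segment onto `S_μ`, continuous because the mass never vanishes; it
  -- fixes the endpoints.
  obtain ⟨f, hf, hcf⟩ : ∃ f : unitInterval → H01 Ω, (∀ t, f t = √(μ / mass (seg t)) • seg t) ∧
      Continuous f :=
    ⟨_, fun _ => rfl, (Real.continuous_sqrt.comp (continuous_const.div
      (continuous_mass.comp hcont) fun t => (hpos t).ne')).smul hcont⟩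
  have hmem : ∀ t, f t ∈ massSphere Ω μ := fun t => by
    rw [hf]
    exact mass_sqrt_smul hμ.le (hpos t)
  have hf0 : f 0 = w₁ := by rw [hf, hs0, e₁', div_self hμ.ne', Real.sqrt_one, one_smul]
  have hf1 : f 1 = w₂ := by rw [hf, hs1, e₂', div_self hμ.ne', Real.sqrt_one, one_smul]
  exact ⟨{
    toFun := fun t => ⟨f t, hmem t⟩
    continuous_toFun := hcf.subtype_mk hmem
    source' := Subtype.ext hf0
    target' := Subtype.ext hf1 }⟩

/-! ### Endpoints and the mountain pass level -/

/-- The end points of the mountain pass. -/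
lemma exists_endpoints (hN : 3 ≤ N) {p r₀ α μ k : ℝ} (hp₁ : 2 + 4 / (N : ℝ) < p)
    (hp₂ : p < 2 * (N : ℝ) / ((N : ℝ) - 2)) (hr₀ : 0 < r₀) (hα : 0 < α)
    (hΩ : MeasurableSet Ω) (hΩc : IsCompact Ωᶜ) (hΩr : ∀ x ∈ Ω, r₀ ≤ ‖x‖) (hμ : 0 < μ)
    (hk : 0 < k) :
    ∃ w₁ w₂ : massSphere Ω μ, 0 ≤ᵐ[volume.restrict Ω] fn w₁.1 ∧
      0 ≤ᵐ[volume.restrict Ω] fn w₂.1 ∧ dirichlet w₁.1 ≤ k / 4 ∧ k < dirichlet w₂.1 ∧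
      ∀ ρ, 1 / 2 ≤ ρ → energy α p ρ w₂.1 ≤ 0 := by
  obtain ⟨hp, hpγ, -, -⟩ := gammaExp_bounds hN hp₁ hp₂
  have hp0 : 0 < p := by linarith
  obtain ⟨R₀, hR₀, hball⟩ := hΩc.isBounded.subset_closedBall_lt 0 0
  -- Ω contains everything outside the ball of radius R₀, so it has room for balls of any radius.
  have hin : ∀ s > 0, ∃ c : Space N, ‖c‖ = R₀ + s + 1 ∧ Metric.closedBall c s ⊆ Ω := by
    intro s hs
    have hc : ‖(EuclideanSpace.single (⟨0, by omega⟩ : Fin N) (R₀ + s + 1) : Space N)‖ =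
        R₀ + s + 1 := by
      rw [PiLp.norm_single, Real.norm_of_nonneg (by positivity)]
    refine ⟨_, hc, fun x hx => ?_⟩
    by_contra hxΩ
    have h1 := mem_closedBall_zero_iff.1 (hball hxΩ)
    have h2 := mem_closedBall_iff_norm'.1 hx
    have h3 := norm_le_norm_add_norm_sub' (EuclideanSpace.single (⟨0, by omega⟩ : Fin N)
      (R₀ + s + 1) : Space N) x
    rw [hc] at h3
    linarith
  obtain ⟨D, hD, B, hB, hfam⟩ := exists_scaled hN hp₁ hp₂ hr₀ hα hΩ hΩr hμ (R₀ + 3)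
  -- At this radius the Dirichlet integral D/s² equals k/4.
  have hs1 : 0 < √(4 * D / k) := Real.sqrt_pos.2 (by positivity)
  obtain ⟨c₁, -, hc₁⟩ := hin _ hs1
  obtain ⟨u₁, hu₁, hpos₁, hd₁, -⟩ := hfam _ hs1 c₁ hc₁
  obtain ⟨c₂, hn₂, hc₂⟩ := hin 1 one_pos
  -- Here t = 1/s. The conditions give D t² > k, then B t^(pγ_p) ≥ p D t², and finally t ≥ 1, so
  -- that the ball stays in the unit ball around c₂, hence within radius R₀ + 3 of the origin.
  have l1 := (tendsto_pow_atTop (α := ℝ) two_ne_zero).eventually_gt_atTop (k / D)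
  have l2 := (tendsto_rpow_atTop (y := p * gammaExp N p - 2) (by linarith)).eventually_ge_atTop
    (p * D / B)
  obtain ⟨t, ht1, ht2, ht3⟩ := (l1.and (l2.and (eventually_ge_atTop 1))).exists
  have ht : 0 < t := by linarith
  have hsub : Metric.closedBall c₂ t⁻¹ ⊆ Metric.closedBall c₂ 1 :=
    Metric.closedBall_subset_closedBall (inv_le_one_of_one_le₀ ht3)
  obtain ⟨u₂, hu₂, hpos₂, hd₂, hw₂⟩ := hfam t⁻¹ (by positivity) c₂ (hsub.trans hc₂)
  rw [inv_inv] at hd₂ hw₂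
  refine ⟨⟨u₁, hu₁⟩, ⟨u₂, hu₂⟩, hpos₁, hpos₂, ?_, ?_, fun ρ hρ => ?_⟩
  · change dirichlet u₁ ≤ k / 4
    rw [hd₁, inv_pow, Real.sq_sqrt (by positivity)]
    apply le_of_eq
    field_simp
  · change k < dirichlet u₂
    rw [hd₂, mul_comm]
    exact (div_lt_iff₀ hD).1 ht1
  · change energy α p ρ u₂ ≤ 0
    have hw := hw₂ (hsub.trans (Metric.closedBall_subset_closedBall' (by
      rw [dist_zero_right, hn₂]; linarith)))
    have e : t ^ (p * gammaExp N p) = t ^ (p * gammaExp N p - 2) * t ^ 2 := by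
      rw [← Real.rpow_natCast t 2, ← Real.rpow_add ht]
      congr 1
      push_cast
      ring
    rw [div_le_iff₀ hB] at ht2
    have h1 : p * (D * t ^ 2) ≤ ∫ x in Ω, ‖x‖ ^ (-α) * |(fn u₂) x| ^ p := by
      refine le_trans ?_ hw
      rw [e]
      nlinarith [mul_le_mul_of_nonneg_right ht2 (sq_nonneg t)]
    -- Only ρ ≥ 1/2 enters, so one w₂ serves every ρ: its potential term absorbs the kinetic term D
    -- t²/2.
    have h2 : 1 / 2 / p * (p * (D * t ^ 2)) ≤
        ρ / p * ∫ x in Ω, ‖x‖ ^ (-α) * |(fn u₂) x| ^ p := by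
      gcongr
    have h3 : 1 / 2 / p * (p * (D * t ^ 2)) = 1 / 2 * (D * t ^ 2) := by field_simp
    rw [energy, hd₂]
    linarith

end ExteriorNLS

end

theorem mainTheorem8 {N : ℕ} (hN : 3 ≤ N) (Ω : Set (EuclideanSpace ℝ (Fin N)))
    (hΩo : IsOpen Ω) (hΩc : IsCompact Ωᶜ)
    (r₀ : ℝ) (hr₀ : 0 < r₀) (hΩr : ∀ x ∈ Ω, r₀ ≤ ‖x‖)
    (α : ℝ) (hα : 0 < α)
    (p : ℝ) (hp₁ : 2 + 4 / (N : ℝ) < p) (hp₂ : p < 2 * (N : ℝ) / ((N : ℝ) - 2))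
    (μ : ℝ) (hμ : 0 < μ) :
    (∀ u : H01 Ω, IntegrableOn (fun x => ‖x‖ ^ (-α) * |(fn u) x| ^ p) Ω) ∧
    0 < kZero N α p r₀ μ ∧
    ∃ w₁ w₂ : massSphere Ω μ,
      Nonempty (Path w₁ w₂) ∧
      (∀ ρ ∈ Set.Icc (1 / 2 : ℝ) 1, ∀ γ : Path w₁ w₂,
        ∃ t₀ : unitInterval, ∀ t : unitInterval,
          energy α p ρ (γ t).1 ≤ energy α p ρ (γ t₀).1) ∧
      (∀ ρ ∈ Set.Icc (1 / 2 : ℝ) 1,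
        max (energy α p ρ w₁.1) (energy α p ρ w₂.1) < mountainPassLevel α p ρ w₁ w₂) ∧
      (∃ δ > 0, ∀ ρ ∈ Set.Icc (1 / 2 : ℝ) 1,
        max (energy α p ρ w₁.1) (energy α p ρ w₂.1) + δ ≤ mountainPassLevel α p ρ w₁ w₂) ∧
      (∀ ρ ∈ Set.Icc (1 / 2 : ℝ) 1,
        kZero N α p r₀ μ / 4 ≤ mountainPassLevel α p ρ w₁ w₂) := by
  have hΩ := hΩo.measurableSet
  have hk := kZero_pos (α := α) hN hp₁ hp₂ hr₀ hμ
  refine ⟨integrableOn_weighted hN hp₁ hp₂ hr₀ hα hΩ hΩr, hk, ?_⟩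
  obtain ⟨w₁, w₂, hpos₁, hpos₂, hd₁, hd₂, hE₂⟩ :=
    exists_endpoints hN hp₁ hp₂ hr₀ hα hΩ hΩc hΩr hμ hk
  set k := kZero N α p r₀ μ with hkdef
  have hne := nonempty_path_of_nonneg hμ w₁ w₂ hpos₁ hpos₂
  have hcont : ∀ ρ (γ : Path w₁ w₂), Continuous fun t => energy α p ρ (γ t).1 := fun ρ γ =>
    (continuous_energy hN hp₁ hp₂ hr₀ hα hΩ hΩr ρ).comp
      (continuous_subtype_val.comp γ.continuous)
  have hlevel : ∀ ρ ∈ Set.Icc (1 / 2 : ℝ) 1, k / 4 ≤ mountainPassLevel α p ρ w₁ w₂ := by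
    intro ρ hρ
    -- This needs `hne`: over an empty set of paths the real infimum would default to 0.
    refine le_ciInf fun γ => ?_
    have hc : Continuous fun t => dirichlet (γ t).1 :=
      continuous_dirichlet.comp (continuous_subtype_val.comp γ.continuous)
    obtain ⟨t, ht⟩ : ∃ t, dirichlet (γ t).1 = k := by
      refine mem_range_of_exists_le_of_exists_ge hc ⟨0, ?_⟩ ⟨1, ?_⟩
      · rw [γ.source]
        linarith
      · rw [γ.target]
        exact hd₂.le
    refine (kZero_div_four_le_energy hN hp₁ hp₂ hr₀ hα hΩ hΩr hμ hρ.2 (γ t).2 ht).trans ?_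
    -- Compactness of the path makes the supremum genuine; an unbounded real supremum would default
    -- to 0.
    exact le_ciSup (isCompact_range (hcont ρ γ)).bddAbove t
  -- At w₁ the potential term only lowers the energy, leaving at most half of k/4; at w₂ the energy
  -- is at most 0.
  have hmax : ∀ ρ ∈ Set.Icc (1 / 2 : ℝ) 1,
      max (energy α p ρ w₁.1) (energy α p ρ w₂.1) ≤ k / 8 := by
    intro ρ hρ
    refine max_le ?_ ((hE₂ ρ hρ.1).trans (by positivity))
    have hp0 : 0 < p := by linarith [(gammaExp_bounds hN hp₁ hp₂).1]
    have : 0 ≤ ρ / p * ∫ x in Ω, ‖x‖ ^ (-α) * |(fn w₁.1) x| ^ p :=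
      mul_nonneg (div_nonneg (by linarith [hρ.1]) hp0.le) (weighted_integral_nonneg _)
    rw [energy]
    linarith
  refine ⟨w₁, w₂, hne, fun ρ _ γ => ?_, fun ρ hρ => ?_, ⟨k / 8, by positivity, fun ρ hρ => ?_⟩,
    hlevel⟩
  · obtain ⟨t₀, -, h⟩ := isCompact_univ.exists_isMaxOn univ_nonempty (hcont ρ γ).continuousOn
    exact ⟨t₀, fun t => h (mem_univ t)⟩
  · linarith [hmax ρ hρ, hlevel ρ hρ]
  · linarith [hmax ρ hρ, hlevel ρ hρ]
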